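/- Let $B$ be a sixth-power-free integer (that is, $d^6 \mid B$ with $d \in \mathbb{Z}$ only for $d = \pm 1$; in particular $B \neq 0$), and let $E_B$ be the quasi-minimal Mordell curve $y^2 = x^3 + B$ over $\mathbb{Q}$. Let $P \in E_B(\mathbb{Q})$ be a rational point of infinite order. Then $[7]P$ is not an integral point, i.e. its coordinates are not both integers. -/

import Mathlib

/-- An integer is sixth-power-free if no sixth power of a non-unit divides it.
In particular `0` is not sixth-power-free. -/
def SixthPowerFree (B : ℤ) : Prop :=
  ∀ d : ℤ, d ^ 6 ∣ B → IsUnit d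

/-- The Mordell curve `E_B : y² = x³ + B` over `ℚ`. -/
def mordellCurve (B : ℤ) : WeierstrassCurve ℚ where
  a₁ := 0
  a₂ := 0
  a₃ := 0
  a₄ := 0
  a₆ := (B : ℚ)

/-- A rational point of `E_B` is integral if it is an affine point both of whose coordinates are
integers. -/
def IsIntegralPoint {B : ℤ} (P : (mordellCurve B).toAffine.Point) : Prop :=
  ∃ (x y : ℤ) (h : (mordellCurve B).toAffine.Nonsingular (x : ℚ) (y : ℚ)),
    P = WeierstrassCurve.Affine.Point.some (x : ℚ) (y : ℚ) h

/-! The abscissa of `7P` is x·G(x³, B)/F(x³, B)² with binary forms F = `divForm` and G = `mulForm`,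
and F = Q·S over ℤ with Q = `quadForm` positive definite. If this abscissa is an integer m, then x
is an integer because G is monic in x³. Writing x³ = Du, B = Dv with u, v coprime, homogeneity gives
m·F(u, v)² = x·G(u, v).

A prime p dividing F(u, v) but neither G(u, v) nor u forces p² ∣ x, hence p⁶ ∣ D ∣ B
(`dvd_sextic_contradiction`). This applies to every prime p ≠ 2, 3 dividing Q(u, v)
(`prime_dvd_quadForm`), so Q(u, v) divides 432 and few ratios u : v remain. Four of them belong to
torsion points; the others are excluded by p = 41 or 43 dividing S. -/

open WeierstrassCurve.Affine

/-! ### Binary forms for multiplication by 7 -/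

section Forms

variable {R : Type*} [CommRing R]

/-- The quadratic factor of the seventh division form. -/
def quadForm (u v : R) : R := 7 * u ^ 2 - 4 * u * v + 16 * v ^ 2

/-- The sextic factor of the seventh division form. -/
def sexticForm (u v : R) : R :=
  u ^ 6 + 564 * u ^ 5 * v - 5808 * u ^ 4 * v ^ 2 - 123136 * u ^ 3 * v ^ 3 - 189696 * u ^ 2 * v ^ 4
    - 49152 * u * v ^ 5 + 4096 * v ^ 6

/-- The seventh division polynomial of `y² = x³ + B` as a binary form in `x³` and `B`. -/
def divForm (u v : R) : R := quadForm u v * sexticForm u v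

/-- The coefficient of `v` in `mulForm u v - u ^ 16`. -/
def mulFormTail (u v : R) : R :=
  -15680 * u ^ 15 + 3099936 * u ^ 14 * v + 117794432 * u ^ 13 * v ^ 2
    + 8046988544 * u ^ 12 * v ^ 3 + 21865396224 * u ^ 11 * v ^ 4 + 332897173504 * u ^ 10 * v ^ 5
    + 819255771136 * u ^ 9 * v ^ 6 - 2232647811072 * u ^ 8 * v ^ 7 - 14287115386880 * u ^ 7 * v ^ 8
    - 20337268883456 * u ^ 6 * v ^ 9 - 8951873667072 * u ^ 5 * v ^ 10
    + 3858860343296 * u ^ 4 * v ^ 11 + 4609305214976 * u ^ 3 * v ^ 12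
    + 1382711033856 * u ^ 2 * v ^ 13 + 548682072064 * u * v ^ 14 + 30064771072 * v ^ 15

/-- The numerator of the abscissa of `7 • (x, y)`, divided by `x`, as a binary form in `x³`
and `B`. -/
def mulForm (u v : R) : R := u ^ 16 + v * mulFormTail u v

theorem divForm_mul_mul (c u v : R) : divForm (c * u) (c * v) = c ^ 8 * divForm u v := by
  simp only [divForm, quadForm, sexticForm]; ring

theorem mulForm_mul_mul (c u v : R) : mulForm (c * u) (c * v) = c ^ 16 * mulForm u v := by
  simp only [mulForm, mulFormTail]; ring

theorem cast_divForm (u v : ℤ) : divForm (u : R) (v : R) = (divForm u v : ℤ) := by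
  simp only [divForm, quadForm, sexticForm]; push_cast; ring

theorem cast_mulForm (u v : ℤ) : mulForm (u : R) (v : R) = (mulForm u v : ℤ) := by
  simp only [mulForm, mulFormTail]; push_cast; ring

/-- Bézout identity eliminating v: a prime dividing both forms divides 3u. -/
theorem quadForm_mul_add_mulForm_mul (u v : R) :
    quadForm u v * (363123689762 * u ^ 15 + 207499240092 * u ^ 14 * v
      - 711423787632 * u ^ 13 * v ^ 2 - 880729488512 * u ^ 12 * v ^ 3
      + 1128518059008 * u ^ 11 * v ^ 4 + 2668983297024 * u ^ 10 * v ^ 5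
      - 829047353344 * u ^ 9 * v ^ 6 - 6179318857728 * u ^ 8 * v ^ 7
      - 3698968559616 * u ^ 7 * v ^ 8 + 3081177399296 * u ^ 6 * v ^ 9
      + 3852903383040 * u ^ 5 * v ^ 10 + 386068905984 * u ^ 4 * v ^ 11
      - 714340302848 * u ^ 3 * v ^ 12 - 203339857920 * u ^ 2 * v ^ 13
      - 129654325248 * u * v ^ 14 - 7516192768 * v ^ 15)
      + mulForm u v * (4 * v - 5 * u) = 3 ^ 26 * u ^ 17 := by
  simp only [quadForm, mulForm, mulFormTail]; ring

end Forms

/-! ### Relations between abscissae of multiples -/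

section GroupLaw

variable {B : ℤ}

theorem mordell_equation {x y : ℚ} (h : (mordellCurve B).toAffine.Nonsingular x y) :
    y ^ 2 = x ^ 3 + B := by
  have := (equation_iff x y).mp h.1
  simpa [mordellCurve] using this

theorem mordell_double_X {x₁ y₁ x₂ y₂ : ℚ} {h₁ : (mordellCurve B).toAffine.Nonsingular x₁ y₁}
    {h₂ : (mordellCurve B).toAffine.Nonsingular x₂ y₂}
    (h : Point.some x₁ y₁ h₁ + Point.some x₁ y₁ h₁ = Point.some x₂ y₂ h₂) :
    x₂ * (4 * (x₁ ^ 3 + B)) = x₁ * (x₁ ^ 3 - 8 * B) := by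
  have hy : y₁ ≠ (mordellCurve B).toAffine.negY x₁ y₁ := by
    intro hy
    rw [Point.add_self_of_Y_eq hy] at h
    exact Point.some_ne_zero h₂ h.symm
  rw [Point.add_self_of_Y_ne hy, Point.some.injEq] at h
  have hx := h.1
  rw [slope_of_Y_ne rfl hy] at hx
  have hy0 : y₁ ≠ 0 := by
    rintro rfl
    simp [mordellCurve, negY] at hy
  simp only [addX, negY, mordellCurve] at hx
  rw [← hx, ← mordell_equation h₁]
  have e := mordell_equation h₁
  have e' : (B : ℚ) = y₁ ^ 2 - x₁ ^ 3 := by linarith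
  rw [e']
  have : y₁ - (-y₁ - 0 * x₁ - 0) = 2 * y₁ := by ring
  rw [this]
  field_simp
  ring

/-- The product is invariant under y₂ ↦ -y₂, so the ordinates enter only through their squares and
can be eliminated. -/
theorem mordell_add_X_mul_sub_X {x₁ y₁ x₂ y₂ x₃ y₃ x₄ y₄ : ℚ}
    {h₁ : (mordellCurve B).toAffine.Nonsingular x₁ y₁}
    {h₂ : (mordellCurve B).toAffine.Nonsingular x₂ y₂}
    {h₃ : (mordellCurve B).toAffine.Nonsingular x₃ y₃}
    {h₄ : (mordellCurve B).toAffine.Nonsingular x₄ y₄} (hx : x₁ ≠ x₂)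
    (hadd : Point.some x₁ y₁ h₁ + Point.some x₂ y₂ h₂ = Point.some x₃ y₃ h₃)
    (hsub : Point.some x₁ y₁ h₁ - Point.some x₂ y₂ h₂ = Point.some x₄ y₄ h₄) :
    x₃ * x₄ * (x₁ - x₂) ^ 2 = (x₁ * x₂) ^ 2 - 4 * B * (x₁ + x₂) := by
  rw [Point.add_of_X_ne hx, Point.some.injEq] at hadd
  rw [sub_eq_add_neg, Point.neg_some, Point.add_of_X_ne hx, Point.some.injEq] at hsub
  have h3 := hadd.1
  have h4 := hsub.1
  rw [slope_of_X_ne hx] at h3 h4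
  simp only [addX, negY, mordellCurve] at h3 h4
  have hd : x₁ - x₂ ≠ 0 := sub_ne_zero.mpr hx
  have e₁ := mordell_equation h₁
  have e₂ := mordell_equation h₂
  have h3' : x₃ * (x₁ - x₂) ^ 2 = (y₁ - y₂) ^ 2 - (x₁ + x₂) * (x₁ - x₂) ^ 2 := by
    rw [← h3]; field_simp; ring
  have h4' : x₄ * (x₁ - x₂) ^ 2 = (y₁ + y₂) ^ 2 - (x₁ + x₂) * (x₁ - x₂) ^ 2 := by
    rw [← h4]; field_simp; ring
  have key : x₃ * x₄ * (x₁ - x₂) ^ 2 * (x₁ - x₂) ^ 2 =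
      ((x₁ * x₂) ^ 2 - 4 * B * (x₁ + x₂)) * (x₁ - x₂) ^ 2 := by
    calc _ = (x₃ * (x₁ - x₂) ^ 2) * (x₄ * (x₁ - x₂) ^ 2) := by ring
      _ = (y₁ ^ 2 - y₂ ^ 2) ^ 2 - 2 * (y₁ ^ 2 + y₂ ^ 2) * ((x₁ + x₂) * (x₁ - x₂) ^ 2)
          + ((x₁ + x₂) * (x₁ - x₂) ^ 2) ^ 2 := by rw [h3', h4']; ring
      _ = _ := by rw [e₁, e₂]; ring
  exact mul_right_cancel₀ (pow_ne_zero 2 hd) key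

/-- The multiples `2 • P, 3 • P, 4 • P, 7 • P` of a point `P = (x, y)` of infinite order have
abscissae `x₂, x₃, x₄, x₇` satisfying the duplication and addition relations. -/
theorem exists_multiples_X {x y : ℚ} (h : (mordellCurve B).toAffine.Nonsingular x y)
    (hP : ¬ IsOfFinAddOrder (Point.some x y h)) {x₇ y₇ : ℚ}
    (h₇ : (mordellCurve B).toAffine.Nonsingular x₇ y₇)
    (e₇ : 7 • Point.some x y h = Point.some x₇ y₇ h₇) :
    ∃ x₂ x₃ x₄ : ℚ, x₂ ≠ x ∧ x₄ ≠ x₂ ∧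
      x₂ * (4 * (x ^ 3 + B)) = x * (x ^ 3 - 8 * B) ∧
      x₄ * (4 * (x₂ ^ 3 + B)) = x₂ * (x₂ ^ 3 - 8 * B) ∧
      x₃ * x * (x₂ - x) ^ 2 = (x₂ * x) ^ 2 - 4 * B * (x₂ + x) ∧
      x₇ * x * (x₄ - x₃) ^ 2 = (x₄ * x₃) ^ 2 - 4 * B * (x₄ + x₃) := by
  set P := Point.some x y h with hPdef
  have hz : ∀ n : ℤ, n ≠ 0 → n • P ≠ 0 := fun n hn h0 ↦
    hP (isOfFinAddOrder_iff_zsmul_eq_zero.mpr ⟨n, hn, h0⟩)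
  have hex : ∀ n : ℤ, n ≠ 0 → ∃ a b, ∃ hab : (mordellCurve B).toAffine.Nonsingular a b,
      n • P = Point.some a b hab := by
    intro n hn
    rcases hc : n • P with _ | ⟨a, b, hab⟩
    · exact absurd hc (hz n hn)
    · exact ⟨a, b, hab, rfl⟩
  have hne : ∀ (m n : ℤ) {a b c d : ℚ} {hab : (mordellCurve B).toAffine.Nonsingular a b}
      {hcd : (mordellCurve B).toAffine.Nonsingular c d}, m • P = Point.some a b hab →
      n • P = Point.some c d hcd → m - n ≠ 0 → m + n ≠ 0 → a ≠ c := by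
    intro m n a b c d hab hcd hm hn h1 h2 hac
    rcases (Point.X_eq_iff (h₁ := hab) (h₂ := hcd)).mp hac with h' | h'
    · rw [← hm, ← hn] at h'
      exact hz _ h1 (by rw [sub_zsmul, h', add_neg_cancel])
    · rw [← hm, ← hn] at h'
      exact hz _ h2 (by rw [add_zsmul, h', neg_add_cancel])
  have e₁ : (1 : ℤ) • P = Point.some x y h := one_smul _ _
  have e₇' : (7 : ℤ) • P = Point.some x₇ y₇ h₇ := by rw [← e₇]; exact ofNat_zsmul P 7
  obtain ⟨x₂, y₂, h₂, e₂⟩ := hex 2 (by norm_num)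
  obtain ⟨x₃, y₃, h₃, e₃⟩ := hex 3 (by norm_num)
  obtain ⟨x₄, y₄, h₄, e₄⟩ := hex 4 (by norm_num)
  have n21 : x₂ ≠ x := hne 2 1 e₂ e₁ (by norm_num) (by norm_num)
  have n43 : x₄ ≠ x₃ := hne 4 3 e₄ e₃ (by norm_num) (by norm_num)
  refine ⟨x₂, x₃, x₄, n21, hne 4 2 e₄ e₂ (by norm_num) (by norm_num), ?_, ?_, ?_, ?_⟩
  · refine mordell_double_X (h₁ := h) (h₂ := h₂) ?_
    rw [← e₁, ← e₂, ← add_zsmul]; rfl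
  · refine mordell_double_X (h₁ := h₂) (h₂ := h₄) ?_
    rw [← e₂, ← e₄, ← add_zsmul]; rfl
  -- 3 = 2 + 1 and 7 = 4 + 3: in both cases the difference is `P` itself.
  · refine mordell_add_X_mul_sub_X (h₁ := h₂) (h₂ := h) (h₃ := h₃) (h₄ := h) n21 ?_ ?_
    · rw [← e₁, ← e₂, ← e₃, ← add_zsmul]; rfl
    · rw [← e₁, ← e₂, sub_eq_add_neg, ← sub_zsmul]; rfl
  · refine mordell_add_X_mul_sub_X (h₁ := h₄) (h₂ := h₃) (h₃ := h₇) (h₄ := h) n43 ?_ ?_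
    · rw [← e₄, ← e₃, ← e₇', ← add_zsmul]; rfl
    · rw [← e₄, ← e₃, ← e₁, sub_eq_add_neg, ← sub_zsmul]; rfl

end GroupLaw

/-! ### The abscissa of 7P -/

/-- The conditions on the abscissae express that the point is not torsion of order dividing `2`,
`3` or `6`. -/
theorem cube_ne_of_multiples {b x x₂ x₄ : ℚ} (hb : b ≠ 0) (n21 : x₂ ≠ x) (n42 : x₄ ≠ x₂)
    (d₂ : x₂ * (4 * (x ^ 3 + b)) = x * (x ^ 3 - 8 * b))
    (d₄ : x₄ * (4 * (x₂ ^ 3 + b)) = x₂ * (x₂ ^ 3 - 8 * b)) :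
    x ≠ 0 ∧ x ^ 3 + b ≠ 0 ∧ x ^ 3 + 4 * b ≠ 0 ∧ x ^ 3 - 8 * b ≠ 0 := by
  have hx : x ≠ 0 := by
    rintro rfl
    apply n21
    have : x₂ * b = 0 := by linarith
    simpa [hb] using this
  have h1 : x ^ 3 + b ≠ 0 := by
    intro h
    have : x * b = 0 := by
      rw [h] at d₂
      have e : x ^ 3 = -b := by linarith
      rw [e] at d₂; linarith
    simp [hb, hx] at this
  refine ⟨hx, h1, fun h ↦ ?_, fun h ↦ ?_⟩
  · apply n21
    have e : x ^ 3 = -4 * b := by linarith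
    rw [e] at d₂
    have : (x₂ - x) * b = 0 := by linarith
    simpa [hb, sub_eq_zero] using this
  · rw [h] at d₂
    have h2 : x₂ = 0 := by simpa [h1] using d₂
    subst h2
    have : x₄ * b = 0 := by linarith
    exact n42 (by simpa [hb] using this)

theorem mul_divForm_sq_eq {b x x₂ x₃ x₄ x₇ : ℚ} (hb : b ≠ 0) (n21 : x₂ ≠ x) (n42 : x₄ ≠ x₂)
    (d₂ : x₂ * (4 * (x ^ 3 + b)) = x * (x ^ 3 - 8 * b))
    (d₄ : x₄ * (4 * (x₂ ^ 3 + b)) = x₂ * (x₂ ^ 3 - 8 * b))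
    (a₃ : x₃ * x * (x₂ - x) ^ 2 = (x₂ * x) ^ 2 - 4 * b * (x₂ + x))
    (a₇ : x₇ * x * (x₄ - x₃) ^ 2 = (x₄ * x₃) ^ 2 - 4 * b * (x₄ + x₃)) :
    x₇ * divForm (x ^ 3) b ^ 2 = x * mulForm (x ^ 3) b := by
  obtain ⟨hx, h1, h4, -⟩ := cube_ne_of_multiples hb n21 n42 d₂ d₄
  have h2 : x₂ ^ 3 + b ≠ 0 := by
    intro h
    rw [h] at d₄
    have e : x₂ ^ 3 = -b := by linarith
    rw [e] at d₄
    have : x₂ * b = 0 := by linarith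
    have h0 : x₂ = 0 := by simpa [hb] using this
    rw [h0] at h
    exact hb (by linarith)
  have hD3 : 9 * x ^ 3 * (x ^ 3 + 4 * b) ^ 2 ≠ 0 := by positivity
  have E₃ : x₃ * (9 * x ^ 3 * (x ^ 3 + 4 * b) ^ 2) =
      x * ((x ^ 3) ^ 3 - 96 * b * (x ^ 3) ^ 2 + 48 * b ^ 2 * x ^ 3 + 64 * b ^ 3) := by
    have hs : (x₂ - x) * (4 * (x ^ 3 + b)) = -3 * x * (x ^ 3 + 4 * b) := by
      rw [sub_mul, d₂]; ring
    apply mul_left_cancel₀ hx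
    calc x * (x₃ * (9 * x ^ 3 * (x ^ 3 + 4 * b) ^ 2))
        = x * (x₃ * x * (-3 * x * (x ^ 3 + 4 * b)) ^ 2) := by ring
      _ = x * ((x₃ * x * (x₂ - x) ^ 2) * (4 * (x ^ 3 + b)) ^ 2) := by rw [← hs]; ring
      _ = x * ((x₂ * (4 * (x ^ 3 + b))) ^ 2 * x ^ 2 - 4 * b * (x₂ * (4 * (x ^ 3 + b))) *
            (4 * (x ^ 3 + b)) - 4 * b * x * (4 * (x ^ 3 + b)) ^ 2) := by rw [a₃]; ring
      _ = _ := by rw [d₂]; ring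
  have hcube : (4 * (x ^ 3 + b)) ^ 3 * (x₂ ^ 3 + b) = ((x ^ 3) ^ 2 + 20 * x ^ 3 * b - 8 * b ^ 2) ^ 2 := by
    calc _ = (x₂ * (4 * (x ^ 3 + b))) ^ 3 + b * (4 * (x ^ 3 + b)) ^ 3 := by ring
      _ = _ := by rw [d₂]; ring
  have hcube' : (4 * (x ^ 3 + b)) ^ 4 * (x₂ * (x₂ ^ 3 - 8 * b)) =
      x * (x ^ 3 - 8 * b) * (x ^ 3 * (x ^ 3 - 8 * b) ^ 3 - 8 * b * (4 * (x ^ 3 + b)) ^ 3) := by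
    calc _ = x₂ * (4 * (x ^ 3 + b)) * ((x₂ * (4 * (x ^ 3 + b))) ^ 3
          - 8 * b * (4 * (x ^ 3 + b)) ^ 3) := by ring
      _ = _ := by rw [d₂]; ring
  have hD4 : 16 * (x ^ 3 + b) * ((x ^ 3) ^ 2 + 20 * x ^ 3 * b - 8 * b ^ 2) ^ 2 ≠ 0 := by
    rw [← hcube]; positivity
  have E₄ : x₄ * (16 * (x ^ 3 + b) * ((x ^ 3) ^ 2 + 20 * x ^ 3 * b - 8 * b ^ 2) ^ 2) =
      x * ((x ^ 3 - 8 * b) * (x ^ 3 * (x ^ 3 - 8 * b) ^ 3 - 8 * b * (4 * (x ^ 3 + b)) ^ 3)) := by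
    rw [← hcube, ← mul_assoc x, ← hcube', ← d₄]; ring
  clear hcube hcube' d₂ d₄ a₃ n21 n42 h2
  -- Now x₃ = x·N₃/D₃ and x₄ = x·N₄/D₄, with all four polynomials in X = x³ and b.
  obtain ⟨X, hX⟩ : ∃ X, X = x ^ 3 := ⟨_, rfl⟩
  rw [← hX] at hD3 hD4 E₃ E₄ ⊢
  obtain ⟨D₃, hD₃⟩ : ∃ D, D = 9 * X * (X + 4 * b) ^ 2 := ⟨_, rfl⟩
  obtain ⟨D₄, hD₄⟩ : ∃ D, D = 16 * (X + b) * (X ^ 2 + 20 * X * b - 8 * b ^ 2) ^ 2 := ⟨_, rfl⟩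
  obtain ⟨N₃, hN₃⟩ : ∃ N, N = X ^ 3 - 96 * b * X ^ 2 + 48 * b ^ 2 * X + 64 * b ^ 3 := ⟨_, rfl⟩
  obtain ⟨N₄, hN₄⟩ : ∃ N, N = (X - 8 * b) * (X * (X - 8 * b) ^ 3 - 8 * b * (4 * (X + b)) ^ 3) :=
    ⟨_, rfl⟩
  rw [← hD₃] at hD3 E₃
  rw [← hD₄] at hD4 E₄
  rw [← hN₃] at E₃
  rw [← hN₄] at E₄
  have hF : N₄ * D₃ - N₃ * D₄ = -divForm X b := by
    rw [hD₃, hD₄, hN₃, hN₄]; simp only [divForm, quadForm, sexticForm]; ring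
  have hG : X * (N₄ * N₃) ^ 2 - 4 * b * (D₃ * D₄) * (N₄ * D₃ + N₃ * D₄) = X * mulForm X b := by
    rw [hD₃, hD₄, hN₃, hN₄]; simp only [mulForm, mulFormTail]; ring
  have hdiff : (x₄ - x₃) * (D₃ * D₄) = -(x * divForm X b) := by
    calc _ = (x₄ * D₄) * D₃ - (x₃ * D₃) * D₄ := by ring
      _ = x * (N₄ * D₃ - N₃ * D₄) := by rw [E₄, E₃]; ring
      _ = _ := by rw [hF]; ring
  apply mul_left_cancel₀ (mul_ne_zero hx (pow_ne_zero 2 hx))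
  calc x * x ^ 2 * (x₇ * divForm X b ^ 2)
      = x₇ * x * (-(x * divForm X b)) ^ 2 := by ring
    _ = (x₇ * x * (x₄ - x₃) ^ 2) * (D₃ * D₄) ^ 2 := by rw [← hdiff]; ring
    _ = ((x₄ * D₄) * (x₃ * D₃)) ^ 2
        - 4 * b * (D₃ * D₄) * ((x₄ * D₄) * D₃ + (x₃ * D₃) * D₄) := by rw [a₇]; ring
    _ = x * (x ^ 3 * (N₄ * N₃) ^ 2 - 4 * b * (D₃ * D₄) * (N₄ * D₃ + N₃ * D₄)) := by
        rw [E₄, E₃]; ring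
    _ = x * x ^ 2 * (x * mulForm X b) := by rw [← hX, hG, hX]; ring

/-! ### Prime divisors of the forms -/

theorem dvd_sextic_contradiction {B D u v x m : ℤ} (hB : SixthPowerFree B) {p : ℤ} (hp : Prime p)
    (hF : p ∣ divForm u v) (hG : ¬ p ∣ mulForm u v) (hu : ¬ p ∣ u)
    (hx : x ^ 3 = D * u) (hD : B = D * v)
    (h : m * divForm u v ^ 2 = x * mulForm u v) : False := by
  have h1 : p ^ 2 ∣ x := by
    have : p ^ 2 ∣ mulForm u v * x := by
      rw [mul_comm, ← h]; exact (pow_dvd_pow_of_dvd hF 2).mul_left m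
    exact (((hp.coprime_iff_not_dvd).mpr hG).pow_left).dvd_of_dvd_mul_left this
  have h2 : p ^ 6 ∣ u * D := by
    rw [mul_comm, ← hx]
    calc p ^ 6 = (p ^ 2) ^ 3 := by ring
      _ ∣ x ^ 3 := pow_dvd_pow_of_dvd h1 3
  have h3 : p ^ 6 ∣ D := (((hp.coprime_iff_not_dvd).mpr hu).pow_left).dvd_of_dvd_mul_left h2
  exact hp.not_isUnit (hB p (hD ▸ h3.mul_right v))

theorem quadForm_pos {u v : ℤ} (h : IsCoprime u v) : 0 < quadForm u v := by
  have : u ≠ 0 ∨ v ≠ 0 := h.ne_zero_or_ne_zero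
  unfold quadForm
  rcases this with h | h
  · nlinarith [sq_pos_of_ne_zero h, sq_nonneg (u - 8 * v)]
  · nlinarith [sq_pos_of_ne_zero h, sq_nonneg (2 * v - 7 * u)]

theorem not_thirtyTwo_dvd_quadForm {u v : ℤ} (h : IsCoprime u v) : ¬ (2 : ℤ) ^ 5 ∣ quadForm u v := by
  rintro ⟨t, ht⟩
  unfold quadForm at ht
  have hu : 2 ∣ 7 * u ^ 2 := ⟨2 ^ 4 * t + 2 * u * v - 8 * v ^ 2, by linarith⟩
  obtain ⟨w, rfl⟩ := Int.prime_two.dvd_of_dvd_pow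
    ((Int.prime_two.dvd_or_dvd hu).resolve_left (by norm_num))
  have hw : 2 ∣ 7 * w ^ 2 := ⟨4 * t + w * v - 2 * v ^ 2, by linarith⟩
  obtain ⟨k, rfl⟩ := Int.prime_two.dvd_of_dvd_pow
    ((Int.prime_two.dvd_or_dvd hw).resolve_left (by norm_num))
  -- Now u = 4k, and the quotient of the form by 16 is odd whenever v is odd.
  have hk : 7 * k ^ 2 - k * v + v ^ 2 = 2 * t := by linarith
  have hv : ¬ Even v := fun hv ↦
    Int.prime_two.not_isUnit (h.isUnit_of_dvd' ⟨2 * k, rfl⟩ hv.two_dvd)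
  have : Even (7 * k ^ 2 - k * v + v ^ 2) := hk ▸ even_two_mul t
  have h7 : ¬ Even (7 : ℤ) := by decide
  by_cases hk : Even k <;> simp [hv, hk, h7, parity_simps] at this

theorem not_eightyOne_dvd_quadForm {u v : ℤ} (h : IsCoprime u v) : ¬ (3 : ℤ) ^ 4 ∣ quadForm u v := by
  rintro ⟨t, ht⟩
  unfold quadForm at ht
  -- Modulo 3 the form is (u + v)².
  have hu : 3 ∣ (u + v) ^ 2 := ⟨3 ^ 3 * t - 2 * u ^ 2 + 2 * u * v - 5 * v ^ 2, by linarith⟩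
  obtain ⟨w, hw⟩ := Int.prime_three.dvd_of_dvd_pow hu
  obtain rfl : u = 3 * w - v := by linarith
  have hw' : 3 ∣ 7 * w ^ 2 := ⟨3 * t + 2 * w * v - v ^ 2, by linarith⟩
  obtain ⟨k, rfl⟩ := Int.prime_three.dvd_of_dvd_pow
    ((Int.prime_three.dvd_or_dvd hw').resolve_left (by norm_num))
  have hv : 3 ∣ v ^ 2 := ⟨t - 7 * k ^ 2 + 2 * k * v, by linarith⟩
  have hv' := Int.prime_three.dvd_of_dvd_pow hv
  exact Int.prime_three.not_isUnit (h.isUnit_of_dvd' (dvd_sub ⟨_, rfl⟩ hv') hv')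

/-- A prime other than `2` and `3` dividing `quadForm u v` divides neither `u` nor `mulForm u v`. -/
theorem prime_dvd_quadForm {u v p : ℤ} (huv : IsCoprime u v) (hp : Prime p) (h2 : ¬ p ∣ 2)
    (h3 : ¬ p ∣ 3) (hq : p ∣ quadForm u v) : ¬ p ∣ u ∧ ¬ p ∣ mulForm u v := by
  have hu : ¬ p ∣ u := by
    intro hu
    have h16 : p ∣ 2 ^ 4 * v ^ 2 := by
      have : (2 : ℤ) ^ 4 * v ^ 2 = quadForm u v - u * (7 * u - 4 * v) := by
        unfold quadForm; ring
      rw [this]; exact dvd_sub hq (hu.mul_right _)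
    rcases hp.dvd_or_dvd h16 with h | h
    · exact h2 (hp.dvd_of_dvd_pow h)
    · exact hp.not_isUnit (huv.isUnit_of_dvd' hu (hp.dvd_of_dvd_pow h))
  refine ⟨hu, fun hG ↦ ?_⟩
  have : p ∣ 3 ^ 26 * u ^ 17 := by
    rw [← quadForm_mul_add_mulForm_mul u v]
    exact dvd_add (hq.mul_right _) (hG.mul_right _)
  rcases hp.dvd_or_dvd this with h | h
  · exact h3 (hp.dvd_of_dvd_pow h)
  · exact hu (hp.dvd_of_dvd_pow h)

/-- 432 = 2⁴·3³ collects the largest powers of 2 and 3 allowed. -/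
theorem quadForm_dvd_of_forall_prime {u v : ℤ} (huv : IsCoprime u v)
    (h : ∀ p : ℤ, Prime p → ¬ p ∣ 2 → ¬ p ∣ 3 → ¬ p ∣ quadForm u v) : quadForm u v ∣ 432 := by
  have hdvd : (quadForm u v).natAbs ∣ 432 := by
    refine (Nat.dvd_iff_prime_pow_dvd_dvd _ _).mpr fun p k hp hk ↦ ?_
    have hle : ∀ n, ¬ ((p : ℤ) ^ (n + 1) ∣ quadForm u v) → p ^ k ∣ p ^ n := by
      intro n hn
      refine pow_dvd_pow p (not_lt.mp fun hlt ↦ hn ?_)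
      have := (pow_dvd_pow p (Nat.succ_le_of_lt hlt)).trans hk
      exact_mod_cast Int.natCast_dvd.mpr this
    by_cases h2 : p = 2
    · subst h2
      exact (hle 4 (by exact_mod_cast not_thirtyTwo_dvd_quadForm huv)).trans (by norm_num)
    by_cases h3 : p = 3
    · subst h3
      exact (hle 3 (by exact_mod_cast not_eightyOne_dvd_quadForm huv)).trans (by norm_num)
    refine (hle 0 ?_).trans (by simp)
    rw [zero_add, pow_one]
    refine h p (Nat.prime_iff_prime_int.mp hp) (fun hd ↦ h2 ?_) (fun hd ↦ h3 ?_)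
    · exact (Nat.prime_dvd_prime_iff_eq hp Nat.prime_two).mp (by exact_mod_cast hd)
    · exact (Nat.prime_dvd_prime_iff_eq hp Nat.prime_three).mp (by exact_mod_cast hd)
  exact Int.natAbs_dvd_natAbs.mp hdvd

theorem ratio_of_quadForm_dvd {u v : ℤ} (huv : IsCoprime u v) (h : quadForm u v ∣ 432) :
    u = -4 * v ∨ u = -v ∨ u = 0 ∨ u = 8 * v ∨ (u = 2 * v ∧ IsUnit v) ∨
      (u = 4 ∧ v = 5) ∨ (u = -4 ∧ v = -5) := by
  have hle : quadForm u v ≤ 432 := Int.le_of_dvd (by norm_num) h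
  -- Completing squares: 4Q = (8v - u)² + 27u² and 7Q = (7u - 2v)² + 108v².
  have hu : u ^ 2 ≤ 8 ^ 2 := by
    unfold quadForm at hle; nlinarith [sq_nonneg (8 * v - u)]
  have hv : v ^ 2 < 6 ^ 2 := by
    unfold quadForm at hle; nlinarith [sq_nonneg (7 * u - 2 * v)]
  have hu' := abs_le_of_sq_le_sq' hu (by norm_num)
  have hv' := abs_lt_of_sq_lt_sq' hv (by norm_num)
  have key : ∀ u ∈ Finset.Icc (-8 : ℤ) 8, ∀ v ∈ Finset.Icc (-5 : ℤ) 5, Int.gcd u v = 1 →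
      7 * u ^ 2 - 4 * u * v + 16 * v ^ 2 ∣ 432 →
      u = -4 * v ∨ u = -v ∨ u = 0 ∨ u = 8 * v ∨ (u = 2 * v ∧ (v = 1 ∨ v = -1)) ∨
      (u = 4 ∧ v = 5) ∨ (u = -4 ∧ v = -5) := by
    decide +kernel
  simpa only [Int.isUnit_iff] using key u (Finset.mem_Icc.mpr hu') v
    (Finset.mem_Icc.mpr ⟨by linarith, by linarith⟩) (Int.isCoprime_iff_gcd_eq_one.mp huv) h

/-- As G is monic in u, clearing denominators shows that the denominator of x divides a power of its
numerator. -/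
theorem int_of_mul_divForm_sq_eq {B m : ℤ} {x : ℚ}
    (h : m * divForm (x ^ 3) (B : ℚ) ^ 2 = x * mulForm (x ^ 3) (B : ℚ)) : ∃ n : ℤ, x = n := by
  have hd : (x.den : ℚ) ≠ 0 := by exact_mod_cast x.den_ne_zero
  obtain ⟨U, hU⟩ : ∃ U, U = x.num ^ 3 := ⟨_, rfl⟩
  obtain ⟨V, hV⟩ : ∃ V, V = (x.den : ℤ) ^ 3 * B := ⟨_, rfl⟩
  have hUq : (x.den : ℚ) ^ 3 * x ^ 3 = U := by
    rw [hU, ← mul_pow, mul_comm, Rat.mul_den_eq_num]; push_cast; rfl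
  have hVq : (x.den : ℚ) ^ 3 * B = V := by rw [hV]; push_cast; rfl
  have key : m * x.den * divForm U V ^ 2 = x.num * mulForm U V := by
    have hF : divForm (U : ℚ) (V : ℚ) = (x.den : ℚ) ^ 24 * divForm (x ^ 3) (B : ℚ) := by
      rw [← hUq, ← hVq, divForm_mul_mul]; ring
    have hG : mulForm (U : ℚ) (V : ℚ) = (x.den : ℚ) ^ 48 * mulForm (x ^ 3) (B : ℚ) := by
      rw [← hUq, ← hVq, mulForm_mul_mul]; ring
    have hq : (m * x.den * divForm (U : ℚ) (V : ℚ) ^ 2 : ℚ) = x.num * mulForm (U : ℚ) (V : ℚ) := by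
      rw [hF, hG, ← Rat.mul_den_eq_num]
      linear_combination (x.den : ℚ) ^ 49 * h
    rw [cast_divForm, cast_mulForm] at hq
    exact_mod_cast hq
  have hdvd : (x.den : ℤ) ∣ x.num ^ 49 := by
    have e : x.num ^ 49 = x.den * (m * divForm U V ^ 2
        - x.num * (x.den : ℤ) ^ 2 * B * mulFormTail U V) := by
      have : x.num ^ 49 = x.num * U ^ 16 := by rw [hU]; ring
      rw [this]
      unfold mulForm at key
      have hV' : V * mulFormTail U V = x.den * ((x.den : ℤ) ^ 2 * B * mulFormTail U V) := by
        nth_rw 1 [hV]; ring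
      rw [hV'] at key
      linear_combination -key
    exact ⟨_, e⟩
  have hcop : IsCoprime (x.den : ℤ) (x.num ^ 49) :=
    (Int.isCoprime_iff_gcd_eq_one.mpr (by simpa [Int.gcd] using x.reduced.symm)).pow_right
  have hunit := hcop.isUnit_of_dvd' dvd_rfl hdvd
  have h1 : x.den = 1 := by simpa [Int.ofNat_isUnit] using hunit
  exact ⟨x.num, (Rat.den_eq_one_iff x).mp h1 |>.symm⟩

theorem mainTheorem8 (B : ℤ) (hB : SixthPowerFree B)
    (P : (mordellCurve B).toAffine.Point) (hP : ¬ IsOfFinAddOrder P) :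
    ¬ IsIntegralPoint (7 • P) := by
  rintro ⟨m, y₇, h₇, e₇⟩
  have hB0 : B ≠ 0 := by
    rintro rfl
    have := hB 2 (dvd_zero _)
    rw [Int.isUnit_iff] at this
    omega
  have hb : (B : ℚ) ≠ 0 := by exact_mod_cast hB0
  rcases P with _ | ⟨x, y, h⟩
  · exact hP .zero
  obtain ⟨x₂, x₃, x₄, n21, n42, d₂, d₄, a₃, a₇⟩ := exists_multiples_X h hP h₇ e₇
  have key := mul_divForm_sq_eq hb n21 n42 d₂ d₄ a₃ a₇
  obtain ⟨hx, h1, h4, h8⟩ := cube_ne_of_multiples hb n21 n42 d₂ d₄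
  obtain ⟨n, rfl⟩ := int_of_mul_divForm_sq_eq key
  have hn : n ≠ 0 := by exact_mod_cast hx
  have hn1 : n ^ 3 + B ≠ 0 := by exact_mod_cast h1
  have hn4 : n ^ 3 + 4 * B ≠ 0 := by exact_mod_cast h4
  have hn8 : n ^ 3 - 8 * B ≠ 0 := by exact_mod_cast h8
  have keyZ : m * divForm (n ^ 3) B ^ 2 = n * mulForm (n ^ 3) B := by
    rw [← Int.cast_pow, cast_divForm, cast_mulForm] at key
    exact_mod_cast key
  obtain ⟨D, u, v, hD, huv, hu, hv⟩ : ∃ D u v : ℤ, D ≠ 0 ∧ IsCoprime u v ∧ n ^ 3 = D * u ∧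
      B = D * v := by
    have hg : 0 < Int.gcd (n ^ 3) B := Int.gcd_pos_of_ne_zero_right _ hB0
    obtain ⟨u, v, huv, hu, hv⟩ := Int.exists_gcd_one hg
    exact ⟨_, u, v, by exact_mod_cast hg.ne', Int.isCoprime_iff_gcd_eq_one.mpr huv,
      hu.trans (mul_comm _ _), hv.trans (mul_comm _ _)⟩
  have keyuv : m * divForm u v ^ 2 = n * mulForm u v := by
    rw [hu, hv, divForm_mul_mul, mulForm_mul_mul] at keyZ
    apply mul_left_cancel₀ (pow_ne_zero 16 hD)
    linear_combination keyZ
  have hq : quadForm u v ∣ 432 := quadForm_dvd_of_forall_prime huv fun p hp h2 h3 hpq ↦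
    have ⟨hpu, hpG⟩ := prime_dvd_quadForm huv hp h2 h3 hpq
    dvd_sextic_contradiction hB hp (hpq.mul_right _) hpG hpu hu hv keyuv
  -- 41 divides S at ±(2, 1) and 43 divides S at ±(4, 5), where Q has only the prime factors 2 and
  -- 3.
  have h41 : Prime (41 : ℤ) := by norm_num
  have h43 : Prime (43 : ℤ) := by norm_num
  rcases ratio_of_quadForm_dvd huv hq with rfl | rfl | rfl | rfl | ⟨rfl, hv1⟩ | ⟨rfl, rfl⟩ |
    ⟨rfl, rfl⟩
  · exact hn4 (by rw [hu, hv]; ring)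
  · exact hn1 (by rw [hu, hv]; ring)
  · exact hn (pow_eq_zero_iff (three_ne_zero) |>.mp (by rw [hu, mul_zero]))
  · exact hn8 (by rw [hu, hv]; ring)
  · rcases Int.isUnit_iff.mp hv1 with rfl | rfl
    all_goals
      refine dvd_sextic_contradiction hB h41 ?_ ?_ ?_ hu hv keyuv <;> decide +kernel
  all_goals
    refine dvd_sextic_contradiction hB h43 ?_ ?_ ?_ hu hv keyuv <;> decide +kernel
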